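/- Let $N\ge 2$, $1<p<N$, and let $\Omega\subset\mathbb{R}^N$ be a bounded open set. Let $a:\Omega\times\mathbb{R}\times\mathbb{R}^N\to\mathbb{R}^N$ be a Carathéodory function such that $$a(x,s,\xi)\cdot\xi\ \ge\ b(s)|\xi|^p\qquad\text{for a.e. }x\in\Omega\text{ and all }s\in\mathbb{R},\ \xi\in\mathbb{R}^N,$$ where $b:\mathbb{R}\to\mathbb{R}$ is continuous and bounded and, for some $\alpha>0$ and $\theta\ge 0$, $b(s)\ge \alpha(1+|s|)^{-\theta(p-1)}$ for all $s\in\mathbb{R}$. Let $h:[0,\infty)\to[0,\infty]$ be continuous and finite on $(0,\infty)$, and suppose that there are $\gamma_2\ge 0$ and $c_2,s_2>0$ with $h(s)\le c_2 s^{-\gamma_2}$ for all $s\ge s_2$. Assume $$0\le\theta\le 1+\frac{\gamma_2}{p-1},$$ and let $0\le f\in L^m(\Omega)$ with $m>\frac Np$ ($m=\infty$ allowed). Then every entropy solution $u$ of $$-\operatorname{div}(a(x,u,\nabla u))=h(u)f\ \text{ in }\Omega,\qquad u\ge 0\ \text{ in }\Omega,\qquad u=0\ \text{ on }\partial\Omega,$$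 belongs to $L^\infty(\Omega)$. Here $T_k(s)=\max(-k,\min(s,k))$. An entropy solution is a nonnegative, measurable, a.e. finite function $u$ on $\Omega$ such that $T_k(u)\in W^{1,p}_0(\Omega)$ for every $k>0$ and such that, for every $k>0$ and every $\varphi\in W^{1,p}_0(\Omega)\cap L^\infty(\Omega)$, $$a(x,T_k(u),\nabla T_k(u))\in L^{\frac{p}{p-1}}(\Omega)^N,\qquad h(u)f\,T_k(u-\varphi)\in L^1(\Omega),$$ $$\int_\Omega a(x,u,\nabla u)\cdot\nabla T_k(u-\varphi)\,dx\ \le\ \int_\Omega h(u)f\,T_k(u-\varphi)\,dx .$$ In the last inequality $\nabla u$ denotes the (a.e. unique) measurable function $v:\Omega\to\mathbb{R}^N$ with $\nabla T_k(u)=v\,\chi_{\{|u|\le k\}}$ a.e. in $\Omega$ for every $k>0$. -/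

import Mathlib

open MeasureTheory Filter Topology
open scoped NNReal ENNReal ContDiff

noncomputable section

/-- Euclidean space `ℝ^N`. -/
abbrev RN (N : ℕ) : Type := EuclideanSpace ℝ (Fin N)

/-- The truncation `T_k(s) = max (-k, min (s, k))`. -/
def trunc (k s : ℝ) : ℝ := max (-k) (min s k)

/-- `φ ∈ C_c^∞(Ω)`. -/
def IsTestFunction {N : ℕ} (Ω : Set (RN N)) (φ : RN N → ℝ) : Prop :=
  ContDiff ℝ ∞ φ ∧ HasCompactSupport φ ∧ tsupport φ ⊆ Ω

/-- `G ∈ L^1_loc(Ω)^N` is a weak (distributional) gradient of `w ∈ L^1_loc(Ω)`: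
`∫_Ω w ∇φ = - ∫_Ω φ G` for all `φ ∈ C_c^∞(Ω)`. -/
structure HasWeakGradient {N : ℕ} (Ω : Set (RN N)) (w : RN N → ℝ) (G : RN N → RN N) : Prop where
  locInt : LocallyIntegrableOn w Ω
  grad_locInt : LocallyIntegrableOn G Ω
  integral_eq : ∀ φ : RN N → ℝ, IsTestFunction Ω φ →
    ∫ x in Ω, w x • gradient φ x = - ∫ x in Ω, φ x • G x

open Classical in
/-- The weak gradient of `w` on `Ω` (unique up to null sets; `0` if there is none). -/
def weakGradient {N : ℕ} (Ω : Set (RN N)) (w : RN N → ℝ) : RN N → RN N :=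
  if H : ∃ G, HasWeakGradient Ω w G then H.choose else 0

/-- `w ∈ W^{1,p}_0(Ω)`: `w ∈ W^{1,p}(Ω)`, and `w` is a limit in the norm of `W^{1,p}(Ω)` of
functions in `C_c^∞(Ω)`. -/
structure MemW01p {N : ℕ} (Ω : Set (RN N)) (p : ℝ) (w : RN N → ℝ) : Prop where
  memLp : MemLp w (ENNReal.ofReal p) (volume.restrict Ω)
  exists_grad : ∃ G, HasWeakGradient Ω w G
  grad_memLp : MemLp (weakGradient Ω w) (ENNReal.ofReal p) (volume.restrict Ω)
  approx : ∃ φ : ℕ → RN N → ℝ, (∀ n, IsTestFunction Ω (φ n)) ∧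
    Tendsto (fun n => eLpNorm (fun x => w x - φ n x) (ENNReal.ofReal p) (volume.restrict Ω))
      atTop (𝓝 0) ∧
    Tendsto (fun n => eLpNorm (fun x => weakGradient Ω w x - gradient (φ n) x)
      (ENNReal.ofReal p) (volume.restrict Ω)) atTop (𝓝 0)

/-- `v` is a generalized gradient of the measurable function `u` all of whose truncations are
in `W^{1,1}_loc(Ω)`: `∇ T_k(u) = v χ_{|u| ≤ k}` for every `k > 0`. -/
def IsGeneralizedGradient {N : ℕ} (Ω : Set (RN N)) (u : RN N → ℝ) (v : RN N → RN N) : Prop :=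
  AEMeasurable v (volume.restrict Ω) ∧
    ∀ k : ℝ, 0 < k →
      HasWeakGradient Ω (fun x => trunc k (u x)) ({x | |u x| ≤ k}.indicator v)

open Classical in
/-- The generalized gradient `∇u` (unique up to null sets; `0` if there is none). -/
def generalizedGradient {N : ℕ} (Ω : Set (RN N)) (u : RN N → ℝ) : RN N → RN N :=
  if H : ∃ v, IsGeneralizedGradient Ω u v then H.choose else 0

/-- `a : Ω × ℝ × ℝ^N → ℝ^N` is a Carathéodory function: measurable in `x` for every `(s, ξ)`,
continuous in `(s, ξ)` for almost every `x`. -/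
def IsCaratheodory {N : ℕ} (Ω : Set (RN N)) (a : RN N → ℝ → RN N → RN N) : Prop :=
  (∀ (s : ℝ) (ξ : RN N), AEMeasurable (fun x => a x s ξ) (volume.restrict Ω)) ∧
    ∀ᵐ x ∂(volume.restrict Ω), Continuous (fun q : ℝ × RN N => a x q.1 q.2)

/-- The right-hand side `h(u) f`, with values in `[0, ∞]` (and `∞ · 0 = 0`). -/
def source {N : ℕ} (h : ℝ≥0 → ℝ≥0∞) (f u : RN N → ℝ) (x : RN N) : ℝ≥0∞ :=
  h (u x).toNNReal * ENNReal.ofReal (f x)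

/-- `u` is an entropy solution to `- div (a(x, u, ∇u)) = h(u) f` in `Ω`, `u ≥ 0` in `Ω`,
`u = 0` on `∂Ω`. The fields `source_finite` and `source_integrable` together say that the
extended-real valued function `h(u) f T_k(u - φ)` is in `L^1(Ω)`. -/
structure IsEntropySolution {N : ℕ} (Ω : Set (RN N)) (p : ℝ) (a : RN N → ℝ → RN N → RN N)
    (h : ℝ≥0 → ℝ≥0∞) (f u : RN N → ℝ) : Prop where
  measurable : AEMeasurable u (volume.restrict Ω)
  nonneg : ∀ᵐ x ∂(volume.restrict Ω), 0 ≤ u x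
  trunc_mem : ∀ k : ℝ, 0 < k → MemW01p Ω p (fun x => trunc k (u x))
  flux_memLp : ∀ k : ℝ, 0 < k →
    MemLp (fun x => a x (trunc k (u x)) (weakGradient Ω (fun y => trunc k (u y)) x))
      (ENNReal.ofReal (p / (p - 1))) (volume.restrict Ω)
  source_finite : ∀ k : ℝ, 0 < k → ∀ φ : RN N → ℝ, MemW01p Ω p φ →
    MemLp φ ∞ (volume.restrict Ω) →
    ∀ᵐ x ∂(volume.restrict Ω),
      source h f u x * ENNReal.ofReal |trunc k (u x - φ x)| ≠ ⊤
  source_integrable : ∀ k : ℝ, 0 < k → ∀ φ : RN N → ℝ, MemW01p Ω p φ →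
    MemLp φ ∞ (volume.restrict Ω) →
    Integrable (fun x => (source h f u x).toReal * trunc k (u x - φ x)) (volume.restrict Ω)
  entropy_le : ∀ k : ℝ, 0 < k → ∀ φ : RN N → ℝ, MemW01p Ω p φ →
    MemLp φ ∞ (volume.restrict Ω) →
    ∫ x in Ω, inner ℝ (a x (u x) (generalizedGradient Ω u x))
        (weakGradient Ω (fun y => trunc k (u y - φ y)) x)
      ≤ ∫ x in Ω, (source h f u x).toReal * trunc k (u x - φ x)

end

/-!
Test the entropy inequality with `φ = T_k(u)` and the truncation `T_j`: only the slice
`{k < u ≤ k + j}` contributes to the left-hand side. For `j ≤ k` the degenerate coercivity costs a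
factor of order `k ^ (θ (p - 1))` there, the decay of `h` gains `k ^ (-γ)`, and since
`θ ≤ 1 + γ / (p - 1)` the total loss is at most `k ^ (p - 1)`. With Sobolev's inequality and
Hölder's inequality for `f`, the measures `A(k) = |{u > k}|` satisfy
`A(k + j) ≤ C (k / j) ^ κ A(k) ^ β`, where `m > N / p` is exactly what makes `β > 1`.
This recursion is invariant under scaling of the levels, so once `A(k₀)` is small enough,
iterating along `k₀ (2 - 2 ^ (-n))` gives `A(2 k₀) = 0`.
-/

section Gradient

variable {E : Type*} [NormedAddCommGroup E] [InnerProductSpace ℝ E] [CompleteSpace E]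

lemma norm_gradient (φ : E → ℝ) (x : E) : ‖gradient φ x‖ = ‖fderiv ℝ φ x‖ := by
  simp [gradient]

lemma continuous_gradient {φ : E → ℝ} (hφ : ContDiff ℝ 1 φ) : Continuous (gradient φ) :=
  (InnerProductSpace.toDual ℝ E).symm.continuous.comp (hφ.continuous_fderiv one_ne_zero)

lemma tsupport_gradient_subset (φ : E → ℝ) : tsupport (gradient φ) ⊆ tsupport φ :=
  closure_minimal (fun x hx => support_fderiv_subset ℝ fun h => hx (by simp [gradient, h]))
    (isClosed_tsupport φ)

lemma gradient_fun_sub {φ ψ : E → ℝ} {x : E} (hφ : DifferentiableAt ℝ φ x)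
    (hψ : DifferentiableAt ℝ ψ x) :
    gradient (fun y => φ y - ψ y) x = gradient φ x - gradient ψ x := by
  simp [gradient, fderiv_fun_sub hφ hψ]

lemma gradient_comp {S : ℝ → ℝ} {φ : E → ℝ} {x : E} (hS : DifferentiableAt ℝ S (φ x))
    (hφ : DifferentiableAt ℝ φ x) :
    gradient (fun y => S (φ y)) x = deriv S (φ x) • gradient φ x := by
  have hcomp : fderiv ℝ (fun y => S (φ y)) x = deriv S (φ x) • fderiv ℝ φ x :=
    (hS.hasDerivAt.comp_hasFDerivAt x hφ.hasFDerivAt).fderiv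
  simp [gradient, hcomp]

end Gradient

section TestFunction

variable {N : ℕ} {Ω : Set (RN N)} {φ ψ : RN N → ℝ}

lemma IsTestFunction.contDiff_one (hφ : IsTestFunction Ω φ) : ContDiff ℝ 1 φ :=
  hφ.1.of_le (by exact_mod_cast le_top)

lemma IsTestFunction.differentiable (hφ : IsTestFunction Ω φ) : Differentiable ℝ φ :=
  hφ.contDiff_one.differentiable one_ne_zero

lemma IsTestFunction.continuous (hφ : IsTestFunction Ω φ) : Continuous φ :=
  hφ.1.continuous

lemma IsTestFunction.continuous_gradient (hφ : IsTestFunction Ω φ) : Continuous (gradient φ) :=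
  _root_.continuous_gradient hφ.contDiff_one

lemma IsTestFunction.hasCompactSupport_gradient (hφ : IsTestFunction Ω φ) :
    HasCompactSupport (gradient φ) :=
  hφ.2.1.of_isClosed_subset (isClosed_tsupport _) (tsupport_gradient_subset φ)

lemma IsTestFunction.eq_zero (hφ : IsTestFunction Ω φ) {x : RN N} (hx : x ∉ Ω) : φ x = 0 :=
  image_eq_zero_of_notMem_tsupport fun h => hx (hφ.2.2 h)

lemma IsTestFunction.gradient_eq_zero (hφ : IsTestFunction Ω φ) {x : RN N} (hx : x ∉ Ω) :
    gradient φ x = 0 :=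
  image_eq_zero_of_notMem_tsupport fun h => hx (hφ.2.2 (tsupport_gradient_subset φ h))

lemma IsTestFunction.sub (hφ : IsTestFunction Ω φ) (hψ : IsTestFunction Ω ψ) :
    IsTestFunction Ω (fun x => φ x - ψ x) :=
  ⟨hφ.1.sub hψ.1, hφ.2.1.sub hψ.2.1,
    (tsupport_sub φ ψ).trans (Set.union_subset hφ.2.2 hψ.2.2)⟩

lemma IsTestFunction.integrable_smul (hφ : IsTestFunction Ω φ) {G : RN N → RN N}
    (hG : LocallyIntegrableOn G Ω) : Integrable (fun x => φ x • G x) :=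
  (integrableOn_iff_integrable_of_support_subset fun _ hx =>
    subset_tsupport φ fun h0 => hx (by simp [h0])).1 <|
    (hG.integrableOn_compact_subset hφ.2.2 hφ.2.1).continuousOn_smul
      hφ.continuous.continuousOn hφ.2.1

lemma IsTestFunction.integrable_smul_gradient (hφ : IsTestFunction Ω φ) {w : RN N → ℝ}
    (hw : LocallyIntegrableOn w Ω) : Integrable (fun x => w x • gradient φ x) :=
  (integrableOn_iff_integrable_of_support_subset fun _ hx =>
    tsupport_gradient_subset φ (subset_tsupport _ fun h0 => hx (by simp [h0]))).1 <|
    (hw.integrableOn_compact_subset hφ.2.2 hφ.2.1).smul_continuousOn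
      hφ.continuous_gradient.continuousOn hφ.2.1

lemma IsTestFunction.integral_smul_gradient (hψ : IsTestFunction Ω ψ) (hφ : ContDiff ℝ 1 φ) :
    ∫ x, φ x • gradient ψ x = - ∫ x, ψ x • gradient φ x := by
  have hi₁ := hψ.integrable_smul_gradient (hφ.continuous.locallyIntegrable.locallyIntegrableOn Ω)
  have hi₂ := hψ.integrable_smul
    ((_root_.continuous_gradient hφ).locallyIntegrable.locallyIntegrableOn Ω)
  have hi₃ : Integrable (fun x => φ x * ψ x) :=
    (hφ.continuous.mul hψ.continuous).integrable_of_hasCompactSupport hψ.2.1.mul_left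
  refine ext_inner_left ℝ fun e => ?_
  rw [inner_neg_right, ← integral_inner hi₁, ← integral_inner hi₂]
  have h₁ (x) : inner ℝ e (φ x • gradient ψ x) = φ x * fderiv ℝ ψ x e := by
    rw [inner_smul_right, inner_gradient_right]; rfl
  have h₂ (x) : inner ℝ e (ψ x • gradient φ x) = fderiv ℝ φ x e * ψ x := by
    rw [inner_smul_right, inner_gradient_right, mul_comm]; rfl
  have hi₁' := hi₁.const_inner (𝕜 := ℝ) e
  have hi₂' := hi₂.const_inner (𝕜 := ℝ) e
  simp only [h₁, h₂] at hi₁' hi₂' ⊢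
  exact integral_mul_fderiv_eq_neg_fderiv_mul_of_integrable hi₂' hi₁' hi₃
    (fun x _ => hφ.differentiable one_ne_zero x) (fun x _ => hψ.differentiable x)

end TestFunction

section WeakGradient

variable {N : ℕ} {Ω : Set (RN N)} {w w' : RN N → ℝ} {G G' : RN N → RN N}

lemma hasWeakGradient_gradient (hw : ContDiff ℝ 1 w) : HasWeakGradient Ω w (gradient w) where
  locInt := hw.continuous.locallyIntegrable.locallyIntegrableOn Ω
  grad_locInt := (continuous_gradient hw).locallyIntegrable.locallyIntegrableOn Ω
  integral_eq ψ hψ := by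
    rw [setIntegral_eq_integral_of_forall_compl_eq_zero fun x hx => by
        simp [hψ.gradient_eq_zero hx],
      setIntegral_eq_integral_of_forall_compl_eq_zero fun x hx => by simp [hψ.eq_zero hx],
      hψ.integral_smul_gradient hw]

lemma hasWeakGradient_weakGradient (h : ∃ G, HasWeakGradient Ω w G) :
    HasWeakGradient Ω w (weakGradient Ω w) := by
  rw [weakGradient, dif_pos h]
  exact h.choose_spec

lemma HasWeakGradient.ae_eq (hΩ : IsOpen Ω) (h : HasWeakGradient Ω w G)
    (h' : HasWeakGradient Ω w' G') (hw : w =ᵐ[volume.restrict Ω] w') :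
    G =ᵐ[volume.restrict Ω] G' := by
  have hzero := hΩ.ae_eq_zero_of_integral_contDiff_smul_eq_zero
    (h.grad_locInt.sub h'.grad_locInt) fun ψ hψ₁ hψ₂ hψ₃ => by
      have hψ : IsTestFunction Ω ψ := ⟨hψ₁, hψ₂, hψ₃⟩
      have hΩψ (G : RN N → RN N) : ∫ x, ψ x • G x = ∫ x in Ω, ψ x • G x :=
        (setIntegral_eq_integral_of_forall_compl_eq_zero fun x hx => by
          simp [hψ.eq_zero hx]).symm
      simp only [Pi.sub_apply, smul_sub]
      rw [integral_sub (hψ.integrable_smul h.grad_locInt) (hψ.integrable_smul h'.grad_locInt),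
        hΩψ, hΩψ, sub_eq_zero, ← neg_inj, ← h.integral_eq ψ hψ, ← h'.integral_eq ψ hψ]
      exact integral_congr_ae (hw.mono fun x hx => by simp only [hx])
  filter_upwards [(ae_restrict_iff' hΩ.measurableSet).2 hzero] with x hx
  exact sub_eq_zero.1 hx

lemma HasWeakGradient.congr (h : HasWeakGradient Ω w G) (hw : w =ᵐ[volume.restrict Ω] w')
    (hG : G =ᵐ[volume.restrict Ω] G') : HasWeakGradient Ω w' G' where
  locInt := h.locInt.congr hw
  grad_locInt := h.grad_locInt.congr hG
  integral_eq ψ hψ := by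
    have hleft : ∫ x in Ω, w' x • gradient ψ x = ∫ x in Ω, w x • gradient ψ x :=
      integral_congr_ae (hw.mono fun x hx => by simp only [hx])
    have hright : ∫ x in Ω, ψ x • G' x = ∫ x in Ω, ψ x • G x :=
      integral_congr_ae (hG.mono fun x hx => by simp only [hx])
    rw [hleft, hright, h.integral_eq ψ hψ]

lemma HasWeakGradient.sub (h : HasWeakGradient Ω w G) (h' : HasWeakGradient Ω w' G') :
    HasWeakGradient Ω (fun x => w x - w' x) (fun x => G x - G' x) where
  locInt := h.locInt.sub h'.locInt
  grad_locInt := h.grad_locInt.sub h'.grad_locInt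
  integral_eq ψ hψ := by
    simp only [sub_smul, smul_sub]
    rw [integral_sub (hψ.integrable_smul_gradient h.locInt).restrict
        (hψ.integrable_smul_gradient h'.locInt).restrict,
      integral_sub (hψ.integrable_smul h.grad_locInt).restrict
        (hψ.integrable_smul h'.grad_locInt).restrict,
      h.integral_eq ψ hψ, h'.integral_eq ψ hψ, neg_sub']

lemma tendsto_integral_of_enorm_sub_le {α E : Type*} [MeasurableSpace α] [NormedAddCommGroup E]
    [NormedSpace ℝ E] {μ : Measure α} {F : ℕ → α → E} {f : α → E} {d : ℕ → α → ℝ≥0∞} {C : ℝ≥0∞}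
    (hF : ∀ n, Integrable (F n) μ) (hf : AEStronglyMeasurable f μ) (hC : C ≠ ⊤)
    (hle : ∀ n x, ‖F n x - f x‖ₑ ≤ C * d n x)
    (hd : Tendsto (fun n => ∫⁻ x, d n x ∂μ) atTop (𝓝 0)) :
    Tendsto (fun n => ∫ x, F n x ∂μ) atTop (𝓝 (∫ x, f x ∂μ)) := by
  refine tendsto_integral_of_L1 f hf (Eventually.of_forall hF) ?_
  have hCd : Tendsto (fun n => C * ∫⁻ x, d n x ∂μ) atTop (𝓝 0) := by
    simpa using ENNReal.Tendsto.const_mul hd (Or.inr hC)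
  refine tendsto_of_tendsto_of_tendsto_of_le_of_le tendsto_const_nhds hCd (fun _ => zero_le)
    fun n => ?_
  exact (lintegral_mono (hle n)).trans_eq (lintegral_const_mul' C _ hC)

lemma HasWeakGradient.of_tendsto {F : ℕ → RN N → ℝ} {H : ℕ → RN N → RN N}
    (h : ∀ n, HasWeakGradient Ω (F n) (H n)) (hw : LocallyIntegrableOn w Ω)
    (hG : LocallyIntegrableOn G Ω)
    (hFw : Tendsto (fun n => ∫⁻ x in Ω, ‖F n x - w x‖ₑ) atTop (𝓝 0))
    (hHG : Tendsto (fun n => ∫⁻ x in Ω, ‖H n x - G x‖ₑ) atTop (𝓝 0)) :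
    HasWeakGradient Ω w G where
  locInt := hw
  grad_locInt := hG
  integral_eq ψ hψ := by
    obtain ⟨A, hA⟩ := hψ.2.1.exists_bound_of_continuous hψ.continuous
    obtain ⟨B, hB⟩ :=
      hψ.hasCompactSupport_gradient.exists_bound_of_continuous hψ.continuous_gradient
    have hleft : Tendsto (fun n => ∫ x in Ω, F n x • gradient ψ x) atTop
        (𝓝 (∫ x in Ω, w x • gradient ψ x)) := by
      refine tendsto_integral_of_enorm_sub_le (C := ENNReal.ofReal B)
        (fun n => (hψ.integrable_smul_gradient (h n).locInt).restrict)
        (hψ.integrable_smul_gradient hw).restrict.1 ENNReal.ofReal_ne_top (fun n x => ?_) hFw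
      rw [← sub_smul, enorm_smul, mul_comm, ← ofReal_norm (gradient ψ x)]
      gcongr
      exact hB x
    have hright : Tendsto (fun n => ∫ x in Ω, ψ x • H n x) atTop (𝓝 (∫ x in Ω, ψ x • G x)) := by
      refine tendsto_integral_of_enorm_sub_le (C := ENNReal.ofReal A)
        (fun n => (hψ.integrable_smul (h n).grad_locInt).restrict)
        (hψ.integrable_smul hG).restrict.1 ENNReal.ofReal_ne_top (fun n x => ?_) hHG
      rw [← smul_sub, enorm_smul, ← ofReal_norm (ψ x)]
      gcongr
      exact hA x
    exact tendsto_nhds_unique (hleft.congr fun n => (h n).integral_eq ψ hψ) hright.neg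

end WeakGradient

section Sobolev

variable {N : ℕ} {Ω : Set (RN N)} {p : ℝ} {w w' : RN N → ℝ}

lemma MemW01p.hasWeakGradient (h : MemW01p Ω p w) : HasWeakGradient Ω w (weakGradient Ω w) :=
  hasWeakGradient_weakGradient h.exists_grad

lemma tendsto_eLpNorm_sub {α E : Type*} [MeasurableSpace α] [NormedAddCommGroup E]
    {μ : Measure α} {q : ℝ≥0∞} (hq : 1 ≤ q) {F F' : ℕ → α → E}
    (hF : ∀ n, AEStronglyMeasurable (F n) μ) (hF' : ∀ n, AEStronglyMeasurable (F' n) μ)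
    (h : Tendsto (fun n => eLpNorm (F n) q μ) atTop (𝓝 0))
    (h' : Tendsto (fun n => eLpNorm (F' n) q μ) atTop (𝓝 0)) :
    Tendsto (fun n => eLpNorm (F n - F' n) q μ) atTop (𝓝 0) :=
  tendsto_of_tendsto_of_tendsto_of_le_of_le tendsto_const_nhds (by simpa using h.add h')
    (fun _ => zero_le) fun n => eLpNorm_sub_le (hF n) (hF' n) hq

lemma MemW01p.weakGradient_sub (hΩ : IsOpen Ω) (h : MemW01p Ω p w) (h' : MemW01p Ω p w') :
    weakGradient Ω (fun x => w x - w' x) =ᵐ[volume.restrict Ω]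
      fun x => weakGradient Ω w x - weakGradient Ω w' x :=
  have hsub := h.hasWeakGradient.sub h'.hasWeakGradient
  (hasWeakGradient_weakGradient ⟨_, hsub⟩).ae_eq hΩ hsub (ae_eq_refl _)

lemma MemW01p.sub (hΩ : IsOpen Ω) (hp : 1 ≤ p) (h : MemW01p Ω p w) (h' : MemW01p Ω p w') :
    MemW01p Ω p (fun x => w x - w' x) where
  memLp := h.memLp.sub h'.memLp
  exists_grad := ⟨_, h.hasWeakGradient.sub h'.hasWeakGradient⟩
  grad_memLp := (memLp_congr_ae (h.weakGradient_sub hΩ h')).2 (h.grad_memLp.sub h'.grad_memLp)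
  approx := by
    obtain ⟨φ, hφ, hφw, hφg⟩ := h.approx
    obtain ⟨ψ, hψ, hψw, hψg⟩ := h'.approx
    have hp' : 1 ≤ ENNReal.ofReal p := by simpa using hp
    refine ⟨fun n x => φ n x - ψ n x, fun n => (hφ n).sub (hψ n),
      (tendsto_eLpNorm_sub hp' (fun n => h.memLp.1.sub (hφ n).continuous.aestronglyMeasurable)
        (fun n => h'.memLp.1.sub (hψ n).continuous.aestronglyMeasurable) hφw hψw).congr
        fun n => eLpNorm_congr_ae (Eventually.of_forall fun x => sub_sub_sub_comm _ _ _ _),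
      (tendsto_eLpNorm_sub hp'
        (fun n => h.grad_memLp.1.sub (hφ n).continuous_gradient.aestronglyMeasurable)
        (fun n => h'.grad_memLp.1.sub (hψ n).continuous_gradient.aestronglyMeasurable)
        hφg hψg).congr fun n => eLpNorm_congr_ae ?_⟩
    filter_upwards [h.weakGradient_sub hΩ h'] with x hx
    rw [hx, gradient_fun_sub ((hφ n).differentiable x) ((hψ n).differentiable x)]
    exact sub_sub_sub_comm _ _ _ _

lemma MemW01p.exists_tendsto_ae (h : MemW01p Ω p w) (hp : 0 < p) :
    ∃ φ : ℕ → RN N → ℝ, (∀ n, IsTestFunction Ω (φ n)) ∧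
      (∀ᵐ x ∂(volume.restrict Ω), Tendsto (fun n => φ n x) atTop (𝓝 (w x))) ∧
      Tendsto (fun n => eLpNorm (fun x => φ n x - w x) (ENNReal.ofReal p) (volume.restrict Ω))
        atTop (𝓝 0) ∧
      Tendsto (fun n => eLpNorm (fun x => gradient (φ n) x - weakGradient Ω w x)
        (ENNReal.ofReal p) (volume.restrict Ω)) atTop (𝓝 0) := by
  obtain ⟨φ, hφ, hφw, hφg⟩ := h.approx
  have hφw' : Tendsto (fun n => eLpNorm (φ n - w) (ENNReal.ofReal p) (volume.restrict Ω))
      atTop (𝓝 0) := hφw.congr fun n => eLpNorm_sub_comm _ _ _ _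
  obtain ⟨ns, hns, hae⟩ := (tendstoInMeasure_of_tendsto_eLpNorm (by simpa using hp)
    (fun n => (hφ n).continuous.aestronglyMeasurable) h.memLp.1 hφw').exists_seq_tendsto_ae
  exact ⟨fun n => φ (ns n), fun n => hφ _, hae, hφw'.comp hns.tendsto_atTop,
    (hφg.congr fun n => eLpNorm_sub_comm _ _ _ _).comp hns.tendsto_atTop⟩

lemma tendsto_lintegral_enorm_of_tendsto_eLpNorm {α E : Type*} [MeasurableSpace α]
    [NormedAddCommGroup E] {μ : Measure α} [IsFiniteMeasure μ] {q : ℝ≥0∞} (hq : 1 ≤ q)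
    {F : ℕ → α → E} (hF : ∀ n, AEStronglyMeasurable (F n) μ)
    (h : Tendsto (fun n => eLpNorm (F n) q μ) atTop (𝓝 0)) :
    Tendsto (fun n => ∫⁻ x, ‖F n x‖ₑ ∂μ) atTop (𝓝 0) := by
  set c := μ Set.univ ^ (1 / (1 : ℝ≥0∞).toReal - 1 / q.toReal)
  have hc : c ≠ ⊤ := by
    refine ENNReal.rpow_ne_top_of_nonneg ?_ (measure_ne_top _ _)
    rcases eq_or_ne q ∞ with rfl | hq'
    · simp
    · simpa using inv_le_one_of_one_le₀ (by simpa using ENNReal.toReal_mono hq' hq)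
  have hlim : Tendsto (fun n => eLpNorm (F n) q μ * c) atTop (𝓝 0) := by
    simpa using ENNReal.Tendsto.mul_const h (Or.inr hc)
  refine tendsto_of_tendsto_of_tendsto_of_le_of_le tendsto_const_nhds hlim (fun _ => zero_le)
    fun n => ?_
  rw [← eLpNorm_one_eq_lintegral_enorm]
  exact eLpNorm_le_eLpNorm_mul_rpow_measure_univ hq (hF n)

lemma tendsto_lintegral_enorm_smul_sub_smul {α E : Type*} [MeasurableSpace α]
    [NormedAddCommGroup E] [NormedSpace ℝ E] {μ : Measure α} {c : ℕ → α → ℝ} {c₀ : α → ℝ}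
    {G : ℕ → α → E} {G₀ : α → E} {L : ℝ} (hc : ∀ n, AEStronglyMeasurable (c n) μ)
    (hcL : ∀ n x, ‖c n x‖ ≤ L) (hlim : ∀ᵐ x ∂μ, Tendsto (fun n => c n x) atTop (𝓝 (c₀ x)))
    (hG₀ : Integrable G₀ μ) (hG : Tendsto (fun n => ∫⁻ x, ‖G n x - G₀ x‖ₑ ∂μ) atTop (𝓝 0)) :
    Tendsto (fun n => ∫⁻ x, ‖c n x • G n x - c₀ x • G₀ x‖ₑ ∂μ) atTop (𝓝 0) := by
  have hfixed : Tendsto (fun n => ∫⁻ x, ‖c n x • G₀ x - c₀ x • G₀ x‖ₑ ∂μ) atTop (𝓝 0) := by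
    simp_rw [← ofReal_norm]
    refine tendsto_lintegral_norm_of_dominated_convergence (bound := fun x => L * ‖G₀ x‖)
      (fun n => (hc n).smul hG₀.1) (hG₀.norm.const_mul L).2
      (fun n => Eventually.of_forall fun x => ?_) (hlim.mono fun x hx => hx.smul_const _)
    rw [norm_smul]
    gcongr
    exact hcL n x
  have hbound : Tendsto (fun n => ENNReal.ofReal L * ∫⁻ x, ‖G n x - G₀ x‖ₑ ∂μ +
      ∫⁻ x, ‖c n x • G₀ x - c₀ x • G₀ x‖ₑ ∂μ) atTop (𝓝 0) := by
    simpa using (ENNReal.Tendsto.const_mul hG (Or.inr ENNReal.ofReal_ne_top)).add hfixed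
  refine tendsto_of_tendsto_of_tendsto_of_le_of_le tendsto_const_nhds hbound (fun _ => zero_le)
    fun n => ?_
  have hc₀ : AEStronglyMeasurable c₀ μ := aestronglyMeasurable_of_tendsto_ae _ hc hlim
  dsimp only
  rw [← lintegral_const_mul' _ _ ENNReal.ofReal_ne_top,
    ← lintegral_add_right' (g := fun x => ‖c n x • G₀ x - c₀ x • G₀ x‖ₑ) _
      (((hc n).smul hG₀.1).sub (hc₀.smul hG₀.1)).enorm]
  refine lintegral_mono fun x => ?_
  have hsplit : c n x • G n x - c₀ x • G₀ x =
      c n x • (G n x - G₀ x) + (c n x • G₀ x - c₀ x • G₀ x) := by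
    rw [smul_sub]; abel
  rw [hsplit]
  refine (enorm_add_le _ _).trans ?_
  rw [enorm_smul, ← ofReal_norm (c n x)]
  gcongr
  exact hcL n x

end Sobolev

section ChainRule

variable {N : ℕ} {Ω : Set (RN N)} [IsFiniteMeasure (volume.restrict Ω)] {p : ℝ} {w : RN N → ℝ}

lemma MemW01p.integrableOn (h : MemW01p Ω p w) (hp : 1 ≤ p) : IntegrableOn w Ω :=
  h.memLp.integrable (by simpa using hp)

lemma MemW01p.integrableOn_weakGradient (h : MemW01p Ω p w) (hp : 1 ≤ p) :
    IntegrableOn (weakGradient Ω w) Ω :=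
  h.grad_memLp.integrable (by simpa using hp)

lemma MemW01p.hasWeakGradient_comp (h : MemW01p Ω p w) (hp : 1 ≤ p) {S : ℝ → ℝ} {L : ℝ≥0}
    (hS : ContDiff ℝ 1 S) (hS₀ : S 0 = 0) (hL : ∀ s, ‖deriv S s‖ ≤ L) :
    HasWeakGradient Ω (fun x => S (w x)) (fun x => deriv S (w x) • weakGradient Ω w x) := by
  obtain ⟨φ, hφ, hae, hφw, hφg⟩ := h.exists_tendsto_ae (zero_lt_one.trans_le hp)
  have hp' : 1 ≤ ENNReal.ofReal p := by simpa using hp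
  have hdS := hS.continuous_deriv_one
  have hSL : LipschitzWith L S :=
    lipschitzWith_of_nnnorm_deriv_le (hS.differentiable one_ne_zero) hL
  have hcomp (n : ℕ) : HasWeakGradient Ω (fun x => S (φ n x))
      (fun x => deriv S (φ n x) • gradient (φ n) x) := by
    have hgrad := hasWeakGradient_gradient (Ω := Ω) (hS.comp (hφ n).contDiff_one)
    exact hgrad.congr (ae_eq_refl _) (Eventually.of_forall fun x =>
      gradient_comp (hS.differentiable one_ne_zero _) ((hφ n).differentiable x))
  have hw := tendsto_lintegral_enorm_of_tendsto_eLpNorm hp'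
    (fun n => (hφ n).continuous.aestronglyMeasurable.sub h.memLp.1) hφw
  have hg := tendsto_lintegral_enorm_of_tendsto_eLpNorm hp'
    (fun n => (hφ n).continuous_gradient.aestronglyMeasurable.sub h.grad_memLp.1) hφg
  refine .of_tendsto hcomp ?_ ?_ ?_ ?_
  · exact IntegrableOn.locallyIntegrableOn
      ((hSL.comp_memLp hS₀ h.memLp).integrable hp')
  · exact IntegrableOn.locallyIntegrableOn <|
      (h.integrableOn_weakGradient hp).bdd_smul L (hdS.comp_aestronglyMeasurable h.memLp.1)
        (Eventually.of_forall fun x => hL _)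
  · refine tendsto_of_tendsto_of_tendsto_of_le_of_le tendsto_const_nhds
      (by simpa using ENNReal.Tendsto.const_mul hw (Or.inr (ENNReal.coe_ne_top (r := L))))
      (fun _ => zero_le) fun n => ?_
    dsimp only
    rw [← lintegral_const_mul' _ _ ENNReal.coe_ne_top]
    refine lintegral_mono fun x => ?_
    simpa only [edist_eq_enorm_sub] using hSL (φ n x) (w x)
  · exact tendsto_lintegral_enorm_smul_sub_smul
      (fun n => (hdS.comp (hφ n).continuous).aestronglyMeasurable) (fun n x => hL _)
      (hae.mono fun x hx => (hdS.tendsto _).comp hx) (h.integrableOn_weakGradient hp) hg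

lemma contDiff_one_integral {g : ℝ → ℝ} (hg : Continuous g) (b : ℝ) :
    ContDiff ℝ 1 (fun s => ∫ t in b..s, g t) :=
  contDiff_one_iff_deriv.2 ⟨fun s => (hg.integral_hasStrictDerivAt b s).hasDerivAt.differentiableAt,
    by simpa only [funext fun s => hg.deriv_integral _ b s] using hg⟩

-- Bounded pointwise convergence `g n → g₀` suffices, so `g₀` may be the indicator of a closed set;
-- truncations then need no separate argument that `∇w = 0` a.e. on level sets.
lemma MemW01p.hasWeakGradient_integral_comp (h : MemW01p Ω p w) (hp : 1 ≤ p) {g : ℕ → ℝ → ℝ}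
    {g₀ : ℝ → ℝ} {L : ℝ≥0} (hg : ∀ n, Continuous (g n)) (hgL : ∀ n s, ‖g n s‖ ≤ L)
    (hlim : ∀ s, Tendsto (fun n => g n s) atTop (𝓝 (g₀ s))) :
    HasWeakGradient Ω (fun x => ∫ t in (0 : ℝ)..w x, g₀ t)
      (fun x => g₀ (w x) • weakGradient Ω w x) := by
  set S : ℕ → ℝ → ℝ := fun n s => ∫ t in (0 : ℝ)..s, g n t
  have hdS (n : ℕ) : deriv (S n) = g n := funext fun s => (hg n).deriv_integral _ 0 s
  have hS (n : ℕ) : ContDiff ℝ 1 (S n) := contDiff_one_integral (hg n) 0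
  have hcomp (n : ℕ) := h.hasWeakGradient_comp hp (L := L) (hS n)
    intervalIntegral.integral_same (by simpa only [hdS] using hgL n)
  have hSL (n : ℕ) (s : ℝ) : ‖S n s‖ ≤ L * ‖s‖ := by
    simpa using intervalIntegral.norm_integral_le_of_norm_le_const (a := 0) (b := s)
      fun t _ => hgL n t
  have hSlim (s : ℝ) : Tendsto (fun n => S n s) atTop (𝓝 (∫ t in (0 : ℝ)..s, g₀ t)) :=
    intervalIntegral.tendsto_integral_filter_of_dominated_convergence (fun _ => (L : ℝ))
      (Eventually.of_forall fun n => (hg n).aestronglyMeasurable)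
      (Eventually.of_forall fun n => Eventually.of_forall fun t _ => hgL n t)
      intervalIntegrable_const (Eventually.of_forall fun t _ => hlim t)
  have hg₀L (s : ℝ) : ‖g₀ s‖ ≤ L := le_of_tendsto' (hlim s).norm fun n => hgL n s
  have hw := (h.integrableOn hp).norm.const_mul (L : ℝ)
  have hmeas (n : ℕ) : AEStronglyMeasurable (fun x => S n (w x)) (volume.restrict Ω) :=
    (hS n).continuous.comp_aestronglyMeasurable h.memLp.1
  have hgmeas (n : ℕ) : AEStronglyMeasurable (fun x => g n (w x)) (volume.restrict Ω) :=
    (hg n).comp_aestronglyMeasurable h.memLp.1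
  refine .of_tendsto hcomp ?_ ?_ ?_ ?_
  · refine IntegrableOn.locallyIntegrableOn <| hw.mono'
      (aestronglyMeasurable_of_tendsto_ae _ hmeas (Eventually.of_forall fun x => hSlim _))
      (Eventually.of_forall fun x => le_of_tendsto' (hSlim _).norm fun n => hSL n _)
  · exact IntegrableOn.locallyIntegrableOn <| (h.integrableOn_weakGradient hp).bdd_smul L
      (aestronglyMeasurable_of_tendsto_ae _ hgmeas (Eventually.of_forall fun x => hlim _))
      (Eventually.of_forall fun x => hg₀L _)
  · simp_rw [← ofReal_norm]
    exact tendsto_lintegral_norm_of_dominated_convergence hmeas hw.2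
      (fun n => Eventually.of_forall fun x => hSL n _) (Eventually.of_forall fun x => hSlim _)
  · simp only [hdS]
    exact tendsto_lintegral_enorm_smul_sub_smul hgmeas (fun n x => hgL n _)
      (Eventually.of_forall fun x => hlim _) (h.integrableOn_weakGradient hp) (by simp)

lemma MemW01p.hasWeakGradient_integral_indicator (h : MemW01p Ω p w) (hp : 1 ≤ p) {F : Set ℝ}
    (hF : IsClosed F) :
    HasWeakGradient Ω (fun x => ∫ t in (0 : ℝ)..w x, F.indicator 1 t)
      ((w ⁻¹' F).indicator (weakGradient Ω w)) := by
  have hlim (s : ℝ) : Tendsto (fun n => (hF.apprSeq n s : ℝ)) atTop (𝓝 (F.indicator 1 s)) := by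
    have hcoe := (NNReal.continuous_coe.tendsto _).comp
      ((tendsto_pi_nhds.1 (HasOuterApproxClosed.tendsto_apprSeq hF)) s)
    refine hcoe.trans_eq ?_
    by_cases hs : s ∈ F <;> simp [hs]
  refine (h.hasWeakGradient_integral_comp hp (L := 1)
    (fun n => NNReal.continuous_coe.comp (hF.apprSeq n).continuous)
    (fun n s => ?_) hlim).congr (ae_eq_refl _) (Eventually.of_forall fun x => ?_)
  · simpa using HasOuterApproxClosed.apprSeq_apply_le_one hF n s
  · by_cases hx : w x ∈ F <;> simp [Set.indicator, hx]

end ChainRule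

section Truncation

variable {k j s : ℝ}

lemma abs_trunc_le (hk : 0 ≤ k) (s : ℝ) : |trunc k s| ≤ k :=
  abs_le.2 ⟨le_max_left _ _, max_le (by linarith) (min_le_right _ _)⟩

lemma trunc_eq_self (hs : |s| ≤ k) : trunc k s = s := by
  rw [trunc, min_eq_left (abs_le.1 hs).2, max_eq_right (abs_le.1 hs).1]

lemma trunc_trunc (hkj : k ≤ j) (hk : 0 ≤ k) (s : ℝ) : trunc k (trunc j s) = trunc k s := by
  grind [trunc]

lemma abs_trunc_le_iff (hkj : k < j) (hk : 0 ≤ k) (s : ℝ) : |trunc j s| ≤ k ↔ |s| ≤ k := by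
  grind [trunc]

lemma trunc_sub_trunc (hk : 0 ≤ k) (hj : 0 ≤ j) (s : ℝ) :
    trunc j (s - trunc k s) = trunc (k + j) s - trunc k s := by
  grind [trunc]

lemma abs_trunc_sub_trunc (hk : 0 ≤ k) (hj : 0 ≤ j) (hs : k + j ≤ |s|) :
    |trunc j (s - trunc k s)| = j := by
  grind [trunc]

lemma integral_indicator_Icc_neg_self (hk : 0 ≤ k) (s : ℝ) :
    ∫ t in (0 : ℝ)..s, (Set.Icc (-k) k).indicator 1 t = trunc k s := by
  have hpos {r : ℝ} (hr : 0 ≤ r) :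
      ∫ t in (0 : ℝ)..r, (Set.Icc (-k) k).indicator 1 t = trunc k r := by
    have hinter : Set.Ioc 0 r ∩ Set.Icc (-k) k = Set.Ioc 0 (trunc k r) := by
      ext t
      grind [trunc]
    have htrunc : 0 ≤ trunc k r := by grind [trunc]
    rw [intervalIntegral.integral_of_le hr, setIntegral_indicator measurableSet_Icc, hinter]
    simp [htrunc]
  rcases le_total 0 s with hs | hs
  · exact hpos hs
  · have heven (t : ℝ) : (Set.Icc (-k) k).indicator (1 : ℝ → ℝ) (-t) =
        (Set.Icc (-k) k).indicator 1 t := by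
      simp only [Set.indicator, Set.mem_Icc, neg_le_neg_iff, neg_le, and_comm, Pi.one_apply]
    have hodd : trunc k (-s) = -trunc k s := by grind [trunc]
    rw [← neg_inj, ← hodd, ← hpos (neg_nonneg.2 hs), ← intervalIntegral.integral_symm, ← neg_zero,
      ← intervalIntegral.integral_comp_neg]
    simp only [heven, neg_zero]

end Truncation

section GeneralizedGradient

variable {N : ℕ} {Ω : Set (RN N)} [IsFiniteMeasure (volume.restrict Ω)] {p k j : ℝ}
  {u w : RN N → ℝ}

lemma MemW01p.hasWeakGradient_trunc (h : MemW01p Ω p w) (hp : 1 ≤ p) (hk : 0 ≤ k) :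
    HasWeakGradient Ω (fun x => trunc k (w x)) ({x | |w x| ≤ k}.indicator (weakGradient Ω w)) := by
  have hset : w ⁻¹' Set.Icc (-k) k = {x | |w x| ≤ k} := Set.ext fun x => abs_le.symm
  simpa only [integral_indicator_Icc_neg_self hk, hset] using
    h.hasWeakGradient_integral_indicator hp (isClosed_Icc (a := -k) (b := k))

lemma weakGradient_trunc_ae_eq_indicator (hΩ : IsOpen Ω) (hp : 1 ≤ p) (hk : 0 ≤ k) (hkj : k < j)
    (hu : MemW01p Ω p (fun x => trunc j (u x))) :
    weakGradient Ω (fun x => trunc k (u x)) =ᵐ[volume.restrict Ω]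
      {x | |u x| ≤ k}.indicator (weakGradient Ω (fun x => trunc j (u x))) := by
  have h := hu.hasWeakGradient_trunc hp hk
  simp only [trunc_trunc hkj.le hk, abs_trunc_le_iff hkj hk] at h
  exact (hasWeakGradient_weakGradient ⟨_, h⟩).ae_eq hΩ h (ae_eq_refl _)

lemma aemeasurable_apply_of_countable {α β ι : Type*} [MeasurableSpace α] [MeasurableSpace β]
    [MeasurableSpace ι] [Countable ι] [MeasurableSingletonClass ι] {μ : Measure α}
    {f : ι → α → β} (hf : ∀ i, AEMeasurable (f i) μ) {i : α → ι} (hi : AEMeasurable i μ) :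
    AEMeasurable (fun x => f (i x) x) μ := by
  have hF : Measurable (fun q : α × ι => (hf q.2).mk _ q.1) :=
    measurable_from_prod_countable_left fun n => (hf n).measurable_mk
  refine ⟨fun x => (hf (hi.mk i x)).mk _ x, hF.comp (measurable_id.prodMk hi.measurable_mk), ?_⟩
  filter_upwards [hi.ae_eq_mk, ae_all_iff.2 fun n => (hf n).ae_eq_mk] with x hix hfx
  rw [hfx, ← hix]

lemma exists_isGeneralizedGradient (hΩ : IsOpen Ω) (hp : 1 ≤ p)
    (hum : AEMeasurable u (volume.restrict Ω))
    (hu : ∀ k : ℝ, 0 < k → MemW01p Ω p (fun x => trunc k (u x))) :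
    ∃ v, IsGeneralizedGradient Ω u v := by
  set g : ℕ → RN N → RN N := fun n => weakGradient Ω (fun y => trunc (n + 1) (u y))
  refine ⟨fun x => g ⌊|u x|⌋₊ x, aemeasurable_apply_of_countable (f := g)
    (fun n => (hu (n + 1) (by positivity)).grad_memLp.1.aemeasurable)
    (Nat.measurable_floor.comp_aemeasurable (continuous_abs.measurable.comp_aemeasurable hum)),
    fun k hk => (hu k hk).hasWeakGradient.congr (ae_eq_refl _) ?_⟩
  have hlevel (n : ℕ) := weakGradient_trunc_ae_eq_indicator (k := n + 1) (j := n + 1 + k) hΩ hp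
    (by positivity) (by linarith) (hu _ (by positivity))
  have hk_level (n : ℕ) := weakGradient_trunc_ae_eq_indicator (k := k) (j := n + 1 + k) hΩ hp
    hk.le (by linarith [n.cast_nonneg (α := ℝ)]) (hu _ (by positivity))
  filter_upwards [ae_all_iff.2 hlevel, ae_all_iff.2 hk_level] with x hx hxk
  rw [hxk ⌊|u x|⌋₊]
  by_cases huk : |u x| ≤ k
  · simp only [Set.indicator, Set.mem_ofPred_eq, huk, if_true, g, hx ⌊|u x|⌋₊,
      (Nat.lt_floor_add_one |u x|).le]
  · simp only [Set.indicator, Set.mem_ofPred_eq, huk, if_false]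

end GeneralizedGradient

section LevelSet

variable {N : ℕ} {Ω : Set (RN N)} {k j : ℝ} {u : RN N → ℝ} {v : RN N → RN N}

lemma isGeneralizedGradient_generalizedGradient (h : ∃ v, IsGeneralizedGradient Ω u v) :
    IsGeneralizedGradient Ω u (generalizedGradient Ω u) := by
  rw [generalizedGradient, dif_pos h]
  exact h.choose_spec

lemma IsGeneralizedGradient.weakGradient_trunc (hΩ : IsOpen Ω) (hv : IsGeneralizedGradient Ω u v)
    (hk : 0 < k) :
    weakGradient Ω (fun x => trunc k (u x)) =ᵐ[volume.restrict Ω] {x | |u x| ≤ k}.indicator v :=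
  (hasWeakGradient_weakGradient ⟨_, hv.2 k hk⟩).ae_eq hΩ (hv.2 k hk) (ae_eq_refl _)

lemma IsGeneralizedGradient.weakGradient_trunc_sub_trunc (hΩ : IsOpen Ω)
    (hv : IsGeneralizedGradient Ω u v) (hk : 0 < k) (hj : 0 < j) :
    weakGradient Ω (fun x => trunc j (u x - trunc k (u x))) =ᵐ[volume.restrict Ω]
      {x | k < |u x| ∧ |u x| ≤ k + j}.indicator v := by
  have h := (hv.2 _ (add_pos hk hj)).sub (hv.2 k hk)
  simp only [← trunc_sub_trunc hk.le hj.le] at h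
  refine ((hasWeakGradient_weakGradient ⟨_, h⟩).ae_eq hΩ h (ae_eq_refl _)).trans
    (Eventually.of_forall fun x => ?_)
  by_cases huk : |u x| ≤ k
  · simp [huk, huk.trans (by linarith : k ≤ k + j), not_lt.2 huk]
  · simp [huk, not_le.1 huk, Set.indicator]

end LevelSet

section Energy

variable {N : ℕ} {Ω : Set (RN N)} {p k j : ℝ} {a : RN N → ℝ → RN N → RN N} {h : ℝ≥0 → ℝ≥0∞}
  {f u : RN N → ℝ}

lemma integrable_inner_of_memLp {α E : Type*} [MeasurableSpace α] {μ : Measure α}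
    [NormedAddCommGroup E] [InnerProductSpace ℝ E] (hp : 1 < p) {F G : α → E}
    (hF : MemLp F (ENNReal.ofReal (p / (p - 1))) μ) (hG : MemLp G (ENNReal.ofReal p) μ) :
    Integrable (fun x => inner ℝ (F x) (G x)) μ := by
  have : (ENNReal.ofReal (p / (p - 1))).HolderConjugate (ENNReal.ofReal p) :=
    (Real.HolderConjugate.conjExponent hp).symm.ennrealOfReal
  exact (hF.norm.integrable_mul hG.norm).mono' (hF.1.inner hG.1)
    (Eventually.of_forall fun x => norm_inner_le_norm _ _)

lemma IsEntropySolution.isGeneralizedGradient [IsFiniteMeasure (volume.restrict Ω)]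
    (hu : IsEntropySolution Ω p a h f u) (hΩ : IsOpen Ω) (hp : 1 ≤ p) :
    IsGeneralizedGradient Ω u (generalizedGradient Ω u) :=
  isGeneralizedGradient_generalizedGradient
    (exists_isGeneralizedGradient hΩ hp hu.measurable hu.trunc_mem)

lemma IsEntropySolution.memW01p_trunc_sub_trunc (hu : IsEntropySolution Ω p a h f u)
    (hΩ : IsOpen Ω) (hp : 1 ≤ p) (hk : 0 < k) (hj : 0 < j) :
    MemW01p Ω p (fun x => trunc j (u x - trunc k (u x))) := by
  simpa only [trunc_sub_trunc hk.le hj.le] using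
    (hu.trunc_mem (k + j) (add_pos hk hj)).sub hΩ hp (hu.trunc_mem k hk)

lemma IsEntropySolution.memLp_top_trunc (hu : IsEntropySolution Ω p a h f u) (hk : 0 < k) :
    MemLp (fun x => trunc k (u x)) ∞ (volume.restrict Ω) :=
  memLp_top_of_bound (hu.trunc_mem k hk).memLp.1 k
    (Eventually.of_forall fun _ => abs_trunc_le hk.le _)

lemma IsEntropySolution.integral_inner_le_integral_source (hu : IsEntropySolution Ω p a h f u)
    (hk : 0 < k) (hj : 0 < j) :
    ∫ x in Ω, inner ℝ (a x (u x) (generalizedGradient Ω u x))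
        (weakGradient Ω (fun y => trunc j (u y - trunc k (u y))) x) ≤
      ∫ x in Ω, (source h f u x).toReal * trunc j (u x - trunc k (u x)) :=
  hu.entropy_le j hj _ (hu.trunc_mem k hk) (hu.memLp_top_trunc hk)

lemma IsEntropySolution.integrableOn_inner_weakGradient [IsFiniteMeasure (volume.restrict Ω)]
    (hu : IsEntropySolution Ω p a h f u) (hΩ : IsOpen Ω) (hp : 1 < p) (hk : 0 < k) (hj : 0 < j) :
    IntegrableOn (fun x => inner ℝ (a x (u x) (generalizedGradient Ω u x))
      (weakGradient Ω (fun y => trunc j (u y - trunc k (u y))) x)) Ω := by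
  have hkj := add_pos hk hj
  have hv := hu.isGeneralizedGradient hΩ hp.le
  refine (integrable_inner_of_memLp hp (hu.flux_memLp _ hkj)
    (hu.memW01p_trunc_sub_trunc hΩ hp.le hk hj).grad_memLp).congr ?_
  filter_upwards [hv.weakGradient_trunc hΩ hkj, hv.weakGradient_trunc_sub_trunc hΩ hk hj]
    with x hflux hlevel
  rw [hlevel, hflux]
  by_cases hx : k < |u x| ∧ |u x| ≤ k + j
  · simp only [Set.indicator, Set.mem_ofPred_eq, hx.2, if_true, trunc_eq_self]
  · simp only [Set.indicator, Set.mem_ofPred_eq, hx, if_false, inner_zero_right]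

lemma IsEntropySolution.mul_integral_norm_rpow_le_integral_inner
    [IsFiniteMeasure (volume.restrict Ω)] (hu : IsEntropySolution Ω p a h f u) (hΩ : IsOpen Ω)
    (hp : 1 < p) (hk : 0 < k) (hj : 0 < j) {c : ℝ}
    (hc : ∀ᵐ x ∂(volume.restrict Ω), ∀ (s : ℝ) (ξ : RN N), |s| ≤ k + j →
      c * ‖ξ‖ ^ p ≤ inner ℝ (a x s ξ) ξ) :
    c * ∫ x in Ω, ‖weakGradient Ω (fun y => trunc j (u y - trunc k (u y))) x‖ ^ p ≤
      ∫ x in Ω, inner ℝ (a x (u x) (generalizedGradient Ω u x))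
        (weakGradient Ω (fun y => trunc j (u y - trunc k (u y))) x) := by
  have hp₀ : 0 < p := zero_lt_one.trans hp
  have hG := (hu.memW01p_trunc_sub_trunc hΩ hp.le hk hj).grad_memLp.integrable_norm_rpow
    (by simpa using hp₀) ENNReal.ofReal_ne_top
  rw [ENNReal.toReal_ofReal hp₀.le] at hG
  rw [← integral_const_mul]
  refine integral_mono_ae (hG.const_mul c) (hu.integrableOn_inner_weakGradient hΩ hp hk hj) ?_
  have hv := hu.isGeneralizedGradient hΩ hp.le
  filter_upwards [hv.weakGradient_trunc_sub_trunc hΩ hk hj, hc] with x hlevel hcx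
  rw [hlevel]
  by_cases hx : k < |u x| ∧ |u x| ≤ k + j
  · simpa only [Set.indicator, Set.mem_ofPred_eq, hx, if_true, true_and] using hcx _ _ hx.2
  · simp only [Set.indicator, Set.mem_ofPred_eq, hx, if_false, inner_zero_right, norm_zero,
      Real.zero_rpow hp₀.ne', mul_zero, le_refl]

lemma source_toReal_le {M : ℝ} {x : RN N} (hM : 0 ≤ M)
    (hh : h (u x).toNNReal ≤ ENNReal.ofReal M) (hf : 0 ≤ f x) :
    (source h f u x).toReal ≤ M * f x := by
  rw [source, ENNReal.toReal_mul, ENNReal.toReal_ofReal hf]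
  exact mul_le_mul_of_nonneg_right (ENNReal.toReal_le_of_le_ofReal hM hh) hf

lemma IsEntropySolution.integral_source_mul_trunc_le (hu : IsEntropySolution Ω p a h f u)
    (hf₀ : ∀ᵐ x ∂(volume.restrict Ω), 0 ≤ f x) (hf : IntegrableOn f Ω) (hk : 0 < k) (hj : 0 < j)
    {M : ℝ} (hM : 0 ≤ M) (hh : ∀ s : ℝ≥0, k < s → h s ≤ ENNReal.ofReal M) :
    ∫ x in Ω, (source h f u x).toReal * trunc j (u x - trunc k (u x)) ≤
      M * (j * ∫ x in {x | k < u x}, f x ∂(volume.restrict Ω)) := by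
  have hset : NullMeasurableSet {x | k < u x} (volume.restrict Ω) :=
    nullMeasurableSet_lt aemeasurable_const hu.measurable
  rw [← mul_assoc, ← integral_indicator₀ hset, ← integral_const_mul]
  refine integral_mono_ae (hu.source_integrable j hj _ (hu.trunc_mem k hk)
    (hu.memLp_top_trunc hk)) ((hf.indicator₀ hset).const_mul _) ?_
  filter_upwards [hu.nonneg, hf₀] with x hux hfx
  by_cases hx : k < u x
  · have hhx : h (u x).toNNReal ≤ ENNReal.ofReal M :=
      hh _ (by rwa [Real.coe_toNNReal _ hux])
    simp only [Set.indicator, Set.mem_ofPred_eq, hx, if_true]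
    rw [mul_right_comm]
    exact mul_le_mul_of_nonneg (source_toReal_le hM hhx hfx)
      ((le_abs_self _).trans (abs_trunc_le hj.le _)) ENNReal.toReal_nonneg hj.le
  · have hzero : trunc j (u x - trunc k (u x)) = 0 := by
      rw [trunc_eq_self ((abs_of_nonneg hux).trans_le (not_lt.1 hx)), sub_self,
        trunc_eq_self (by simpa using hj.le)]
    simp only [Set.indicator, Set.mem_ofPred_eq, hx, if_false, hzero, mul_zero, le_refl]

lemma IsEntropySolution.integral_norm_weakGradient_rpow_le [IsFiniteMeasure (volume.restrict Ω)]
    (hu : IsEntropySolution Ω p a h f u) (hΩ : IsOpen Ω) (hp : 1 < p) {α θ : ℝ} (hα : 0 < α)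
    (hθ : 0 ≤ θ)
    (ha : ∀ᵐ x ∂(volume.restrict Ω), ∀ (s : ℝ) (ξ : RN N),
      α / (1 + |s|) ^ (θ * (p - 1)) * ‖ξ‖ ^ p ≤ inner ℝ (a x s ξ) ξ)
    {γ c : ℝ} {s₀ : ℝ≥0} (hγ : 0 ≤ γ) (hc : 0 < c)
    (hh : ∀ s : ℝ≥0, s₀ ≤ s → h s ≤ ENNReal.ofReal (c / (s : ℝ) ^ γ))
    (hθγ : θ ≤ 1 + γ / (p - 1)) (hf₀ : ∀ᵐ x ∂(volume.restrict Ω), 0 ≤ f x)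
    (hf : IntegrableOn f Ω) (hk : max 1 (s₀ : ℝ) ≤ k) (hj : 0 < j) (hjk : j ≤ k) :
    ∫ x in Ω, ‖weakGradient Ω (fun y => trunc j (u y - trunc k (u y))) x‖ ^ p ≤
      c / α * 3 ^ (θ * (p - 1)) *
        (k ^ (p - 1) * (j * ∫ x in {x | k < u x}, f x ∂(volume.restrict Ω))) := by
  obtain ⟨hk₁, hks⟩ := max_le_iff.1 hk
  have hk₀ : 0 < k := zero_lt_one.trans_le hk₁
  have hp₁ : 0 < p - 1 := sub_pos.2 hp
  set R := j * ∫ x in {x | k < u x}, f x ∂(volume.restrict Ω)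
  have hR : 0 ≤ R := mul_nonneg hj.le (integral_nonneg_of_ae (ae_restrict_of_ae hf₀))
  have hcoer : ∀ᵐ x ∂(volume.restrict Ω), ∀ (s : ℝ) (ξ : RN N), |s| ≤ k + j →
      α / (3 * k) ^ (θ * (p - 1)) * ‖ξ‖ ^ p ≤ inner ℝ (a x s ξ) ξ := by
    filter_upwards [ha] with x hx s ξ hs
    refine le_trans ?_ (hx s ξ)
    gcongr
    linarith
  have hsource (s : ℝ≥0) (hs : k < s) : h s ≤ ENNReal.ofReal (c / k ^ γ) :=
    (hh s (NNReal.coe_le_coe.1 (hks.trans hs.le))).trans (by gcongr)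
  have henergy := ((hu.mul_integral_norm_rpow_le_integral_inner hΩ hp hk₀ hj hcoer).trans
    (hu.integral_inner_le_integral_source hk₀ hj)).trans
    (hu.integral_source_mul_trunc_le hf₀ hf hk₀ hj (by positivity) hsource)
  have hexp : θ * (p - 1) - γ ≤ p - 1 := by
    have hθγ' := mul_le_mul_of_nonneg_right hθγ hp₁.le
    rw [add_mul, div_mul_cancel₀ _ hp₁.ne'] at hθγ'
    linarith
  rw [Real.mul_rpow (by norm_num) hk₀.le, div_mul_eq_mul_div, div_le_iff₀ (by positivity)]
    at henergy
  calc _ ≤ c / α * 3 ^ (θ * (p - 1)) * (k ^ (θ * (p - 1)) / k ^ γ * R) := by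
        rw [← mul_le_mul_iff_right₀ hα]
        exact henergy.trans_eq (by field_simp; rfl)
    _ ≤ c / α * 3 ^ (θ * (p - 1)) * (k ^ (p - 1) * R) := by
        rw [← Real.rpow_sub hk₀]
        gcongr

end Energy

section SobolevInequality

variable {N : ℕ} {Ω : Set (RN N)} {p : ℝ} {w : RN N → ℝ}

lemma MemW01p.eLpNorm_le_mul_eLpNorm_weakGradient (h : MemW01p Ω p w) (hp : 1 ≤ p) {q : ℝ≥0∞}
    {C : ℝ≥0} (hC : ∀ φ : RN N → ℝ, IsTestFunction Ω φ → eLpNorm φ q (volume.restrict Ω) ≤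
      C * eLpNorm (gradient φ) (ENNReal.ofReal p) (volume.restrict Ω)) :
    eLpNorm w q (volume.restrict Ω) ≤
      C * eLpNorm (weakGradient Ω w) (ENNReal.ofReal p) (volume.restrict Ω) := by
  obtain ⟨φ, hφ, hae, -, hφg⟩ := h.exists_tendsto_ae (zero_lt_one.trans_le hp)
  have hbound (n : ℕ) : eLpNorm (φ n) q (volume.restrict Ω) ≤
      C * (eLpNorm (fun x => gradient (φ n) x - weakGradient Ω w x) (ENNReal.ofReal p)
        (volume.restrict Ω) +
        eLpNorm (weakGradient Ω w) (ENNReal.ofReal p) (volume.restrict Ω)) := by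
    refine (hC _ (hφ n)).trans ?_
    gcongr
    have htriangle := eLpNorm_add_le (p := ENNReal.ofReal p)
      ((hφ n).continuous_gradient.aestronglyMeasurable.sub h.grad_memLp.1) h.grad_memLp.1
      (by simpa using hp)
    rwa [sub_add_cancel] at htriangle
  have hlim := ENNReal.Tendsto.const_mul (a := (C : ℝ≥0∞))
    (hφg.add_const (eLpNorm (weakGradient Ω w) (ENNReal.ofReal p) (volume.restrict Ω)))
    (Or.inr ENNReal.coe_ne_top)
  rw [zero_add] at hlim
  refine (Lp.eLpNorm_lim_le_liminf_eLpNorm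
    (fun n => (hφ n).continuous.aestronglyMeasurable) w hae).trans ?_
  exact (liminf_le_liminf (Eventually.of_forall hbound)).trans_eq hlim.liminf_eq

lemma IsTestFunction.eLpNorm_le_mul_eLpNorm_gradient (hN : 0 < N) {p q : ℝ≥0} (hp : 1 ≤ p)
    (hq : (q : ℝ)⁻¹ = (p : ℝ)⁻¹ - (N : ℝ)⁻¹) {φ : RN N → ℝ} (hφ : IsTestFunction Ω φ) :
    eLpNorm φ q (volume.restrict Ω) ≤ SNormLESNormFDerivOfEqConst ℝ (volume : Measure (RN N)) p *
      eLpNorm (gradient φ) p (volume.restrict Ω) := by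
  rw [eLpNorm_restrict_eq_of_support_subset fun x hx => by_contra fun hxΩ => hx (hφ.eq_zero hxΩ),
    eLpNorm_restrict_eq_of_support_subset fun x hx =>
      by_contra fun hxΩ => hx (hφ.gradient_eq_zero hxΩ),
    eLpNorm_congr_norm_ae (Eventually.of_forall (norm_gradient φ))]
  exact eLpNorm_le_eLpNorm_fderiv_of_eq volume hφ.contDiff_one hφ.2.1 hp (by simpa using hN)
    (by simpa using hq)

lemma exists_eLpNorm_le_mul_eLpNorm_weakGradient (hp : 1 ≤ p) (hpN : p < N) :
    ∃ C : ℝ≥0, ∀ w : RN N → ℝ, MemW01p Ω p w →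
      eLpNorm w (ENNReal.ofReal (N * p / (N - p))) (volume.restrict Ω) ≤
        C * eLpNorm (weakGradient Ω w) (ENNReal.ofReal p) (volume.restrict Ω) := by
  have hp₀ : 0 < p := zero_lt_one.trans_le hp
  have hN : (0 : ℝ) < N := hp₀.trans hpN
  have hNp : 0 < N - p := sub_pos.2 hpN
  refine ⟨_, fun w hw => hw.eLpNorm_le_mul_eLpNorm_weakGradient hp fun φ hφ =>
    hφ.eLpNorm_le_mul_eLpNorm_gradient (by exact_mod_cast hN) (by simpa using hp) ?_⟩
  rw [Real.coe_toNNReal _ hp₀.le, Real.coe_toNNReal _ (by positivity)]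
  field_simp

end SobolevInequality

section LebesgueNorm

variable {α E : Type*} [MeasurableSpace α] [NormedAddCommGroup E] {μ : Measure α}

lemma measureReal_norm_ge_le {q : ℝ} (hq : 0 < q) {w : α → E} (hw : MemLp w (ENNReal.ofReal q) μ)
    {j : ℝ} (hj : 0 < j) :
    μ.real {x | j ≤ ‖w x‖} ≤ (lpNorm w (ENNReal.ofReal q) μ / j) ^ q := by
  have hq' : ENNReal.ofReal q ≠ 0 := by simpa using hq
  have hmarkov := mul_meas_ge_le_pow_eLpNorm' μ hq' ENNReal.ofReal_ne_top hw.1 (ENNReal.ofReal j)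
  simp only [← ofReal_norm, ENNReal.ofReal_le_ofReal_iff (norm_nonneg _),
    ENNReal.toReal_ofReal hq.le] at hmarkov
  have hreal := ENNReal.toReal_mono
    (ENNReal.rpow_ne_top_of_nonneg hq.le hw.eLpNorm_ne_top) hmarkov
  rw [ENNReal.toReal_mul, ← ENNReal.toReal_rpow, ← ENNReal.toReal_rpow,
    ENNReal.toReal_ofReal hj.le, toReal_eLpNorm hw.1] at hreal
  rw [Real.div_rpow lpNorm_nonneg hj.le, le_div_iff₀' (by positivity)]
  exact hreal

lemma setIntegral_le_lpNorm_mul_measureReal_rpow {m : ℝ≥0∞} (hm : 1 ≤ m) {f : α → ℝ}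
    (hf : MemLp f m μ) {s : Set α} (hs : μ s ≠ ⊤) :
    ∫ x in s, f x ∂μ ≤ lpNorm f m μ * μ.real s ^ (1 - m⁻¹.toReal) := by
  have hholder : eLpNorm f 1 (μ.restrict s) ≤ eLpNorm f m μ * μ s ^ (1 - m⁻¹.toReal) := by
    refine (eLpNorm_le_eLpNorm_mul_rpow_measure_univ hm hf.1.restrict).trans ?_
    rw [Measure.restrict_apply_univ, ENNReal.toReal_inv, ENNReal.toReal_one, div_one, one_div]
    gcongr
    exact Measure.restrict_le_self
  have hexp : 0 ≤ 1 - m⁻¹.toReal :=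
    sub_nonneg.2 (ENNReal.toReal_le_of_le_ofReal zero_le_one (by simpa using hm))
  rw [← toReal_eLpNorm hf.1, Measure.real, ENNReal.toReal_rpow, ← ENNReal.toReal_mul]
  refine ((le_abs_self _).trans (norm_integral_le_lintegral_norm f)).trans (ENNReal.toReal_mono
    (ENNReal.mul_ne_top hf.eLpNorm_ne_top (ENNReal.rpow_ne_top_of_nonneg hexp hs)) ?_)
  simpa only [eLpNorm_one_eq_lintegral_enorm, ← ofReal_norm] using hholder

lemma tendsto_measureReal_lt_atTop [IsFiniteMeasure μ] {u : α → ℝ} (hu : AEMeasurable u μ) :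
    Tendsto (fun t : ℝ => μ.real {x | t < u x}) atTop (𝓝 0) := by
  have hinter : ⋂ t : ℝ, {x | t < u x} = ∅ :=
    Set.eq_empty_of_forall_notMem fun x hx => lt_irrefl (u x) (Set.mem_iInter.1 hx (u x))
  have hlim := tendsto_measure_iInter_atTop (μ := μ) (s := fun t : ℝ => {x | t < u x})
    (fun t => nullMeasurableSet_lt aemeasurable_const hu)
    (fun s t hst x hx => hst.trans_lt hx) ⟨0, measure_ne_top _ _⟩
  rw [hinter, measure_empty] at hlim
  exact (ENNReal.tendsto_toReal ENNReal.zero_ne_top).comp hlim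

end LebesgueNorm

section Iteration

lemma exists_forall_tendsto_zero_of_le_mul_rpow {C B β : ℝ} (hC : 0 ≤ C) (hB : 1 < B)
    (hβ : 1 < β) :
    ∃ δ > 0, ∀ y : ℕ → ℝ, (∀ n, 0 ≤ y n) → (∀ n, y (n + 1) ≤ C * B ^ n * y n ^ β) → y 0 ≤ δ →
      Tendsto y atTop (𝓝 0) := by
  have hB₀ : 0 < B := zero_lt_one.trans hB
  have hβ₀ : 0 < β - 1 := sub_pos.2 hβ
  set r := B ^ (-(β - 1)⁻¹) with hr
  have hr₀ : 0 < r := Real.rpow_pos_of_pos hB₀ _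
  have hr₁ : r < 1 := Real.rpow_lt_one_of_one_lt_of_neg hB (neg_neg_of_pos (inv_pos.2 hβ₀))
  have hBr : B * r ^ (β - 1) = 1 := by
    rw [hr, ← Real.rpow_mul hB₀.le, neg_mul, inv_mul_cancel₀ hβ₀.ne', Real.rpow_neg_one,
      mul_inv_cancel₀ hB₀.ne']
  set δ := (r / (C + 1)) ^ (β - 1)⁻¹ with hδ
  have hδ₀ : 0 < δ := by positivity
  have hCδ : C * δ ^ (β - 1) ≤ r := by
    rw [hδ, Real.rpow_inv_rpow (by positivity) hβ₀.ne', mul_div_left_comm]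
    exact mul_le_of_le_one_right hr₀.le ((div_le_one (by positivity)).2 (by linarith))
  refine ⟨δ, hδ₀, fun y hy₀ hy hyδ => ?_⟩
  have hgeom (n : ℕ) : y n ≤ δ * r ^ n := by
    induction n with
    | zero => simpa using hyδ
    | succ n ih =>
      have hpow : (δ * r ^ n) ^ β = δ ^ (β - 1) * (r ^ (β - 1)) ^ n * (δ * r ^ n) := by
        rw [← sub_add_cancel β 1, Real.rpow_add_one (by positivity), add_sub_cancel_right,
          Real.mul_rpow hδ₀.le (by positivity), Real.rpow_pow_comm hr₀.le]
      calc y (n + 1) ≤ C * B ^ n * y n ^ β := hy n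
        _ ≤ C * B ^ n * (δ * r ^ n) ^ β := by gcongr; exact hy₀ n
        _ = C * δ ^ (β - 1) * (B * r ^ (β - 1)) ^ n * (δ * r ^ n) := by
          rw [hpow, mul_pow]; ring
        _ ≤ r * (δ * r ^ n) := by rw [hBr, one_pow, mul_one]; gcongr
        _ = δ * r ^ (n + 1) := by ring
  exact squeeze_zero hy₀ hgeom
    (by simpa using (tendsto_pow_atTop_nhds_zero_of_lt_one hr₀.le hr₁).const_mul δ)

lemma exists_eq_zero_of_le_div_rpow_mul_rpow {A : ℝ → ℝ} (hA₀ : ∀ t, 0 ≤ A t) (hA : Antitone A)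
    (hlim : Tendsto A atTop (𝓝 0)) {C κ β K : ℝ} (hC : 0 ≤ C) (hκ : 0 < κ) (hβ : 1 < β)
    (hdecay : ∀ k j, K ≤ k → 0 < j → j ≤ k → A (k + j) ≤ C * (k / j) ^ κ * A k ^ β) :
    ∃ k, A k = 0 := by
  obtain ⟨δ, hδ, hδA⟩ := exists_forall_tendsto_zero_of_le_mul_rpow (C := C * 4 ^ κ)
    (B := 2 ^ κ) (by positivity) (Real.one_lt_rpow one_lt_two hκ) hβ
  obtain ⟨k₀, hk₀δ, hk₀K, hk₀⟩ := ((hlim.eventually_le_const hδ).and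
    ((eventually_ge_atTop K).and (eventually_gt_atTop 0))).exists
  set t : ℕ → ℝ := fun n => 2⁻¹ ^ n
  have ht₀ (n : ℕ) : 0 < t n := by positivity
  have ht₁ (n : ℕ) : t n ≤ 1 := pow_le_one₀ (by norm_num) (by norm_num)
  set level : ℕ → ℝ := fun n => k₀ * (2 - t n)
  have hle_level (n : ℕ) : k₀ ≤ level n := le_mul_of_one_le_right hk₀.le (by linarith [ht₁ n])
  have hlevel_le (n : ℕ) : level n ≤ k₀ * 2 :=
    mul_le_mul_of_nonneg_left (by linarith [ht₀ n]) hk₀.le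
  have hstep_le (n : ℕ) : k₀ * t (n + 1) ≤ level n :=
    (mul_le_of_le_one_right hk₀.le (ht₁ _)).trans (hle_level n)
  have hlevel_succ (n : ℕ) : level (n + 1) = level n + k₀ * t (n + 1) := by
    simp only [level, t, pow_succ]; ring
  have hratio (n : ℕ) : level n / (k₀ * t (n + 1)) ≤ 4 * 2 ^ n := by
    refine (div_le_div_of_nonneg_right (hlevel_le n) (by positivity)).trans_eq ?_
    simp only [t, pow_succ, inv_pow]
    field_simp
    norm_num
  have hdecay_level (n : ℕ) : A (level (n + 1)) ≤ C * 4 ^ κ * (2 ^ κ) ^ n * A (level n) ^ β := by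
    have hlevel₀ : 0 ≤ level n := hk₀.le.trans (hle_level n)
    have hA₀n := hA₀ (level n)
    calc A (level (n + 1)) ≤ C * (level n / (k₀ * t (n + 1))) ^ κ * A (level n) ^ β := by
          rw [hlevel_succ]
          exact hdecay _ _ (hk₀K.trans (hle_level n)) (by positivity) (hstep_le n)
      _ ≤ C * (4 * 2 ^ n) ^ κ * A (level n) ^ β := by gcongr; exact hratio n
      _ = C * 4 ^ κ * (2 ^ κ) ^ n * A (level n) ^ β := by
          rw [Real.mul_rpow (by norm_num) (by positivity), Real.rpow_pow_comm zero_le_two,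
            ← mul_assoc]
  have hlevel_lim := hδA (fun n => A (level n)) (fun n => hA₀ _) hdecay_level
    ((hA (hle_level 0)).trans hk₀δ)
  exact ⟨k₀ * 2, le_antisymm (ge_of_tendsto' hlevel_lim fun n => hA (hlevel_le n)) (hA₀ _)⟩

end Iteration

section LevelDecay

variable {N : ℕ} {Ω : Set (RN N)} {p : ℝ} {a : RN N → ℝ → RN N → RN N} {h : ℝ≥0 → ℝ≥0∞}
  {f u : RN N → ℝ}

lemma exists_measureReal_abs_ge_le_mul_rpow (Ω : Set (RN N)) (hp : 1 ≤ p) (hpN : p < N) :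
    ∃ C, 0 ≤ C ∧ ∀ w : RN N → ℝ, MemW01p Ω p w → ∀ j : ℝ, 0 < j →
      (volume.restrict Ω).real {x | j ≤ |w x|} ≤
        C * ((∫ x in Ω, ‖weakGradient Ω w x‖ ^ p) / j ^ p) ^ (N / (N - p)) := by
  have hp₀ : 0 < p := zero_lt_one.trans_le hp
  have hNp : 0 < N - p := sub_pos.2 hpN
  have hN : (0 : ℝ) < N := hp₀.trans hpN
  obtain ⟨C, hC⟩ := exists_eLpNorm_le_mul_eLpNorm_weakGradient (Ω := Ω) hp hpN
  set q := N * p / (N - p)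
  have hq : 0 < q := by positivity
  refine ⟨C ^ q, by positivity, fun w hw j hj => ?_⟩
  have hgrad_fin := ENNReal.mul_ne_top (ENNReal.coe_ne_top (r := C)) hw.grad_memLp.eLpNorm_ne_top
  have hwq : MemLp w (ENNReal.ofReal q) (volume.restrict Ω) :=
    ⟨hw.memLp.1, (hC w hw).trans_lt hgrad_fin.lt_top⟩
  have hsobolev := ENNReal.toReal_mono hgrad_fin (hC w hw)
  rw [ENNReal.toReal_mul, ENNReal.coe_toReal, toReal_eLpNorm hw.memLp.1,
    toReal_eLpNorm hw.grad_memLp.1, lpNorm_eq_integral_norm_rpow_toReal (by simpa using hp₀)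
      ENNReal.ofReal_ne_top hw.grad_memLp.1, ENNReal.toReal_ofReal hp₀.le] at hsobolev
  set I := ∫ x in Ω, ‖weakGradient Ω w x‖ ^ p
  have hI : 0 ≤ I := integral_nonneg fun x => by positivity
  calc _ ≤ (lpNorm w (ENNReal.ofReal q) (volume.restrict Ω) / j) ^ q :=
        measureReal_norm_ge_le hq hwq hj
    _ ≤ (C * I ^ p⁻¹ / j) ^ q := by
        gcongr
        exact div_nonneg lpNorm_nonneg hj.le
    _ = C ^ q * ((I / j ^ p) ^ p⁻¹) ^ q := by
        rw [Real.div_rpow hI (by positivity), Real.rpow_rpow_inv hj.le hp₀.ne', mul_div_assoc,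
          Real.mul_rpow C.coe_nonneg (by positivity)]
    _ = C ^ q * (I / j ^ p) ^ (N / (N - p)) := by
        rw [← Real.rpow_mul (by positivity)]
        congr 2
        simp only [q]
        field_simp

lemma measureReal_lt_add_le {α : Type*} [MeasurableSpace α] {μ : Measure α} [IsFiniteMeasure μ]
    (g : α → ℝ) {k j : ℝ} (hk : 0 ≤ k) (hj : 0 ≤ j) :
    μ.real {x | k + j < g x} ≤ μ.real {x | j ≤ |trunc j (g x - trunc k (g x))|} :=
  measureReal_mono fun x (hx : k + j < g x) =>
    (abs_trunc_sub_trunc hk hj (hx.le.trans (le_abs_self _))).ge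

lemma IsEntropySolution.exists_measureReal_lt_add_le [IsFiniteMeasure (volume.restrict Ω)]
    (hu : IsEntropySolution Ω p a h f u) (hΩ : IsOpen Ω) (hp : 1 < p) (hpN : p < N) {α θ : ℝ}
    (hα : 0 < α) (hθ : 0 ≤ θ)
    (ha : ∀ᵐ x ∂(volume.restrict Ω), ∀ (s : ℝ) (ξ : RN N),
      α / (1 + |s|) ^ (θ * (p - 1)) * ‖ξ‖ ^ p ≤ inner ℝ (a x s ξ) ξ)
    {γ c : ℝ} {s₀ : ℝ≥0} (hγ : 0 ≤ γ) (hc : 0 < c)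
    (hh : ∀ s : ℝ≥0, s₀ ≤ s → h s ≤ ENNReal.ofReal (c / (s : ℝ) ^ γ))
    (hθγ : θ ≤ 1 + γ / (p - 1)) (hf₀ : ∀ᵐ x ∂(volume.restrict Ω), 0 ≤ f x)
    {m : ℝ≥0∞} (hm : 1 ≤ m) (hf : MemLp f m (volume.restrict Ω)) :
    ∃ C, 0 ≤ C ∧ ∀ k j : ℝ, max 1 (s₀ : ℝ) ≤ k → 0 < j → j ≤ k →
      (volume.restrict Ω).real {x | k + j < u x} ≤ C * (k / j) ^ ((p - 1) * (N / (N - p))) *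
        (volume.restrict Ω).real {x | k < u x} ^ ((1 - m⁻¹.toReal) * (N / (N - p))) := by
  have : 0 < N - p := sub_pos.2 hpN
  obtain ⟨S, hS, hweak⟩ := exists_measureReal_abs_ge_le_mul_rpow Ω hp.le hpN
  set F := lpNorm f m (volume.restrict Ω)
  have hF : 0 ≤ F := lpNorm_nonneg
  set D := c / α * 3 ^ (θ * (p - 1))
  have hD : 0 < D := by positivity
  refine ⟨S * (D * F) ^ (N / (N - p)), by positivity, fun k j hk hj hjk => ?_⟩
  have hk₀ : 0 < k := hj.trans_le hjk
  set A := (volume.restrict Ω).real {x | k < u x}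
  have hA : 0 ≤ A := measureReal_nonneg
  set I := ∫ x in Ω, ‖weakGradient Ω (fun y => trunc j (u y - trunc k (u y))) x‖ ^ p
  have : 0 ≤ I := integral_nonneg fun x => by positivity
  have henergy : I / j ^ p ≤ D * F * (k / j) ^ (p - 1) * A ^ (1 - m⁻¹.toReal) := by
    calc I / j ^ p ≤ D * (k ^ (p - 1) * (j * (F * A ^ (1 - m⁻¹.toReal)))) / j ^ p := by
          gcongr
          refine (hu.integral_norm_weakGradient_rpow_le hΩ hp hα hθ ha hγ hc hh hθγ hf₀
            (hf.integrable hm) hk hj hjk).trans ?_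
          gcongr
          exact setIntegral_le_lpNorm_mul_measureReal_rpow hm hf (measure_ne_top _ _)
      _ = D * F * (k / j) ^ (p - 1) * A ^ (1 - m⁻¹.toReal) := by
          rw [Real.div_rpow hk₀.le hj.le, ← sub_add_cancel p 1, Real.rpow_add_one hj.ne',
            add_sub_cancel_right]
          field_simp
  calc _ ≤ S * (I / j ^ p) ^ (N / (N - p)) :=
        (measureReal_lt_add_le u hk₀.le hj.le).trans
          (hweak _ (hu.memW01p_trunc_sub_trunc hΩ hp.le hk₀ hj) j hj)
    _ ≤ S * (D * F * (k / j) ^ (p - 1) * A ^ (1 - m⁻¹.toReal)) ^ (N / (N - p)) := by gcongr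
    _ = _ := by
        rw [Real.mul_rpow (by positivity) (by positivity),
          Real.mul_rpow (by positivity) (by positivity), ← Real.rpow_mul (by positivity),
          ← Real.rpow_mul hA, ← mul_assoc, ← mul_assoc]

lemma one_lt_one_sub_inv_mul_div {n : ℝ} (hp : 0 < p) (hpn : p < n) {m : ℝ≥0∞}
    (hm : ENNReal.ofReal (n / p) < m) : 1 < (1 - m⁻¹.toReal) * (n / (n - p)) := by
  have hnp : 0 < n - p := sub_pos.2 hpn
  have hn : 0 < n := hp.trans hpn
  have hinv : m⁻¹.toReal < p / n := by
    have h := ENNReal.inv_lt_inv.2 hm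
    rw [← ENNReal.ofReal_inv_of_pos (by positivity), inv_div] at h
    exact (ENNReal.lt_ofReal_iff_toReal_lt h.ne_top).1 h
  rw [mul_div_assoc', lt_div_iff₀ hnp, one_mul]
  rw [lt_div_iff₀ hn] at hinv
  linarith

end LevelDecay

theorem mainTheorem7_general {N : ℕ} {p : ℝ} (hp : 1 < p) (hpN : p < N) {Ω : Set (RN N)}
    (hΩ : IsOpen Ω) (hΩ_fin : volume Ω ≠ ⊤) {a : RN N → ℝ → RN N → RN N} {α θ : ℝ} (hα : 0 < α)
    (hθ : 0 ≤ θ)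
    (ha : ∀ᵐ x ∂(volume.restrict Ω), ∀ (s : ℝ) (ξ : RN N),
      α / (1 + |s|) ^ (θ * (p - 1)) * ‖ξ‖ ^ p ≤ inner ℝ (a x s ξ) ξ)
    {h : ℝ≥0 → ℝ≥0∞} {γ c : ℝ} {s₀ : ℝ≥0} (hγ : 0 ≤ γ) (hc : 0 < c)
    (hh : ∀ s : ℝ≥0, s₀ ≤ s → h s ≤ ENNReal.ofReal (c / (s : ℝ) ^ γ))
    (hθγ : θ ≤ 1 + γ / (p - 1))
    {f : RN N → ℝ} (hf₀ : ∀ᵐ x ∂(volume.restrict Ω), 0 ≤ f x)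
    {m : ℝ≥0∞} (hm : ENNReal.ofReal (N / p) < m) (hf : MemLp f m (volume.restrict Ω))
    {u : RN N → ℝ} (hu : IsEntropySolution Ω p a h f u) :
    MemLp u ∞ (volume.restrict Ω) := by
  have : IsFiniteMeasure (volume.restrict Ω) := isFiniteMeasure_restrict.2 hΩ_fin
  have hp₀ : 0 < p := zero_lt_one.trans hp
  have hm₁ : 1 ≤ m := le_trans (by simpa using (one_le_div hp₀).2 hpN.le) hm.le
  obtain ⟨C, hC, hdecay⟩ :=
    hu.exists_measureReal_lt_add_le hΩ hp hpN hα hθ ha hγ hc hh hθγ hf₀ hm₁ hf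
  obtain ⟨k, hk⟩ := exists_eq_zero_of_le_div_rpow_mul_rpow
    (A := fun t => (volume.restrict Ω).real {x | t < u x}) (fun _ => measureReal_nonneg)
    (fun _ _ hst => measureReal_mono fun _ hx => hst.trans_lt hx)
    (tendsto_measureReal_lt_atTop hu.measurable) hC
    (mul_pos (sub_pos.2 hp) (div_pos (hp₀.trans hpN) (sub_pos.2 hpN)))
    (one_lt_one_sub_inv_mul_div hp₀ hpN hm) hdecay
  refine memLp_top_of_bound hu.measurable.aestronglyMeasurable k ?_
  filter_upwards [measure_eq_zero_iff_ae_notMem.1 ((measureReal_eq_zero_iff).1 hk), hu.nonneg]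
    with x hx hux
  exact (abs_of_nonneg hux).trans_le (not_lt.1 hx)

theorem mainTheorem7 {N : ℕ} (hN : 2 ≤ N) (p : ℝ) (hp1 : 1 < p) (hpN : p < N)
    (Ω : Set (RN N)) (hΩo : IsOpen Ω) (hΩb : Bornology.IsBounded Ω)
    (a : RN N → ℝ → RN N → RN N) (ha : IsCaratheodory Ω a)
    (b : ℝ → ℝ) (hb_cont : Continuous b) (hb_bdd : ∃ B : ℝ, ∀ s, |b s| ≤ B)
    (ha_coer : ∀ᵐ x ∂(volume.restrict Ω), ∀ (s : ℝ) (ξ : RN N),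
      b s * ‖ξ‖ ^ p ≤ inner ℝ (a x s ξ) ξ)
    (α θ : ℝ) (hα : 0 < α) (hθ : 0 ≤ θ)
    (hb : ∀ s : ℝ, α / (1 + |s|) ^ (θ * (p - 1)) ≤ b s)
    (h : ℝ≥0 → ℝ≥0∞) (hh_cont : ContinuousOn h (Set.Ioi 0))
    (hh_fin : ∀ s : ℝ≥0, 0 < s → h s ≠ ⊤)
    (γ₂ c₂ : ℝ) (s₂ : ℝ≥0) (hγ₂ : 0 ≤ γ₂) (hc₂ : 0 < c₂) (hs₂ : 0 < s₂)
    (hh : ∀ s : ℝ≥0, s₂ ≤ s → h s ≤ ENNReal.ofReal (c₂ / (s : ℝ) ^ γ₂))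
    (hθγ : θ ≤ 1 + γ₂ / (p - 1))
    (f : RN N → ℝ) (hf_nonneg : ∀ᵐ x ∂(volume.restrict Ω), 0 ≤ f x)
    (m : ℝ≥0∞) (hm : ENNReal.ofReal (N / p) < m) (hf : MemLp f m (volume.restrict Ω))
    (u : RN N → ℝ) (hu : IsEntropySolution Ω p a h f u) :
    MemLp u ∞ (volume.restrict Ω) :=
  mainTheorem7_general hp1 hpN hΩo hΩb.measure_lt_top.ne hα hθ
    (ha_coer.mono fun x hx s ξ =>
      (mul_le_mul_of_nonneg_right (hb s) (by positivity)).trans (hx s ξ))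
    hγ₂ hc₂ hh hθγ hf_nonneg hm hf hu
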